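/- For $n\ge 1$ let $\mathcal{T}_n$ be the set of unlabelled trees with $n$ vertices, that is, of isomorphism classes of trees with $n$ vertices. Call a vertex $v$ of a tree $T$ fixed if its orbit under the automorphism group of $T$ is $\{v\}$, that is, if every automorphism of $T$ maps $v$ to itself. Then almost every tree in $\mathcal{T}_n$ has more than $\lfloor n/24\rfloor$ fixed vertices: $$\lim_{n\to\infty}\frac{\bigl|\{T\in\mathcal{T}_n : T \text{ has more than } \lfloor n/24\rfloor \text{ fixed vertices}\}\bigr|}{|\mathcal{T}_n|}=1 .$$ -/

import Mathlib

/-- Two trees on the vertex set `Fin n` are identified when they are isomorphic as graphs. -/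
instance treeSetoid (n : ℕ) : Setoid {G : SimpleGraph (Fin n) // G.IsTree} where
  r G H := Nonempty (G.1 ≃g H.1)
  iseqv :=
    { refl := fun _ => ⟨SimpleGraph.Iso.refl⟩
      symm := fun ⟨e⟩ => ⟨e.symm⟩
      trans := fun ⟨e⟩ ⟨f⟩ => ⟨e.trans f⟩ }

/-- The set of (unlabelled) trees with `n` vertices: isomorphism classes of trees on `Fin n`. -/
def UnlabelledTree (n : ℕ) : Type :=
  Quotient (treeSetoid n)

instance (n : ℕ) : Finite (UnlabelledTree n) :=
  inferInstanceAs (Finite (Quotient (treeSetoid n)))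

/-- The vertex class of `v`: all vertices to which `v` is mapped by some automorphism of `G`. -/
def vertexClass {V : Type*} (G : SimpleGraph V) (v : V) : Set V :=
  {u | ∃ φ : G ≃g G, φ v = u}

/-- A vertex is fixed if it forms a vertex class on its own. -/
def IsFixedVertex {V : Type*} (G : SimpleGraph V) (v : V) : Prop :=
  vertexClass G v = {v}

/-- The number of fixed vertices of a graph (used for finite graphs only). -/
noncomputable def fixedVertexCount {V : Type*} (G : SimpleGraph V) : ℕ :=
  {v : V | IsFixedVertex G v}.ncard

theorem isFixedVertex_iff {V : Type*} (G : SimpleGraph V) (v : V) :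
    IsFixedVertex G v ↔ ∀ φ : G ≃g G, φ v = v := by
  constructor
  · intro h φ
    have h1 : φ v ∈ vertexClass G v := ⟨φ, rfl⟩
    rw [IsFixedVertex] at h
    rw [h] at h1
    exact h1
  · intro h
    ext u
    constructor
    · rintro ⟨φ, rfl⟩
      exact h φ
    · intro hu
      exact ⟨SimpleGraph.Iso.refl, hu.symm⟩

theorem isFixedVertex_map {V W : Type*} {G : SimpleGraph V} {H : SimpleGraph W} (e : G ≃g H)
    {v : V} (hv : IsFixedVertex G v) : IsFixedVertex H (e v) := by
  rw [isFixedVertex_iff] at hv ⊢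
  intro φ
  have h := hv ((e.trans φ).trans e.symm)
  have h2 : e.symm (φ (e v)) = v := h
  exact e.symm.injective (h2.trans (e.symm_apply_apply v).symm)

theorem fixedVertexCount_congr {V W : Type*} {G : SimpleGraph V} {H : SimpleGraph W}
    (e : G ≃g H) : fixedVertexCount G = fixedVertexCount H := by
  unfold fixedVertexCount
  refine Set.ncard_congr (fun v _ => e v) (fun v hv => isFixedVertex_map e hv)
    (fun a b _ _ h => e.injective h) ?_
  intro w hw
  exact ⟨e.symm w, isFixedVertex_map e.symm hw, e.apply_symm_apply w⟩

/-- The number of fixed vertices of an unlabelled tree (that of any representative). -/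
noncomputable def UnlabelledTree.fixedVertexCount {n : ℕ} (T : UnlabelledTree n) : ℕ :=
  Quotient.lift (s := treeSetoid n) (fun G : {G : SimpleGraph (Fin n) // G.IsTree} => _root_.fixedVertexCount G.1)
    (fun _ _ ⟨e⟩ => fixedVertexCount_congr e) T

/-- The probability of the property `Q` when all unlabelled trees with `n` vertices are equally
likely. -/
noncomputable def treeProb (n : ℕ) (Q : UnlabelledTree n → Prop) : ℝ :=
  (Nat.card {T : UnlabelledTree n // Q T} : ℝ) / (Nat.card (UnlabelledTree n) : ℝ)

/-- Almost every tree with `n` vertices has the property `Q`: its probability tends to `1` as `n`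
tends to infinity. -/
def AlmostEveryTree (Q : (n : ℕ) → UnlabelledTree n → Prop) : Prop :=
  Filter.Tendsto (fun n : ℕ => treeProb n (Q n)) Filter.atTop (nhds 1)

/-!
The proof compares two exponential growth rates.

*Many trees.* There are at least `n ^ (n - 1)` labelled rooted trees with `n` vertices. This follows
from Pitman's double count: a rooted forest with `k` edges becomes one with `k + 1` edges when one of
its roots is hung below an arbitrary vertex of another tree (`card_forestFuns_succ`). An unlabelled
tree has at most `n` rootings and `n!` labellings, so there are at least `n ^ (n - 2) / n!` unlabelled
trees (`pow_le_card_unlabelledTree`), a number of growth rate `e`.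

*Few trees with few fixed vertices.* The sum of the distances to a vertex is invariant under
automorphisms, and every vertex of a tree has at most one neighbour where this sum is not larger
(`SimpleGraph.IsTree.eq_of_distSum_le`). Moving to the neighbour with a smaller sum therefore turns
the tree canonically into a rooted forest with one root or two adjacent roots, which determines the
tree and has the same automorphisms. In a rooted forest, the trees at the roots of one orbit of the
automorphism group are isomorphic. Below the fixed vertices, all trees thus occur with
multiplicities `m ≥ 2`, and writing `m = 2 * a + 3 * b` with `b ≤ 1` one sees that a doubled forest and
a tripled forest suffice to describe them. A forest on `n` vertices with `k` fixed ones is encoded in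
this way by binary trees with at most `(n + 5 * k) / 2` nodes altogether (`IsForest.exists_core`).
As there are at most `4 ^ (N + 1)` binary trees with at most `N` nodes, and `k ≤ n / 24`, at most
`64 * (5 / 2) ^ n` trees have at most `n / 24` fixed vertices (`card_few_fixed_le`).

Since `5 / 2 < e`, the second number is negligible in comparison with the first.
-/

/-! ### Isomorphism classes of forests -/

/-- A relation on a type, read as `parent x y`: the vertex `y` is the parent of the vertex `x`. -/
structure ParentRel where
  /-- The vertices. -/
  V : Type
  /-- `parent x y` says that `y` is the parent of `x`. -/
  parent : V → V → Prop

/-- Parent relations are identified when they are isomorphic. -/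
instance parentRelSetoid : Setoid ParentRel where
  r F G := Nonempty (F.parent ≃r G.parent)
  iseqv :=
    { refl := fun _ => ⟨RelIso.refl _⟩
      symm := fun ⟨e⟩ => ⟨e.symm⟩
      trans := fun ⟨e⟩ ⟨f⟩ => ⟨e.trans f⟩ }

/-- Isomorphism classes of parent relations. The classes of finite forests are the unlabelled rooted
forests; no condition on the relation is imposed, since the operations below need none. -/
def ForestClass : Type 1 := Quotient parentRelSetoid

/-- The isomorphism class of a parent relation. -/
def forestClass {V : Type} (r : V → V → Prop) : ForestClass := Quotient.mk _ ⟨V, r⟩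

theorem forestClass_eq_iff {V W : Type} {r : V → V → Prop} {s : W → W → Prop} :
    forestClass r = forestClass s ↔ Nonempty (r ≃r s) :=
  Quotient.eq (r := parentRelSetoid)

/-- The parent relation obtained by adding a new vertex `none`, which becomes the parent of all
former roots. -/
def coneRel {V : Type} (r : V → V → Prop) : Option V → Option V → Prop
  | none, _ => False
  | some x, some y => r x y
  | some x, none => ∀ y, ¬ r x y

namespace ForestClass

theorem ind {P : ForestClass → Prop} (h : ∀ (V : Type) (r : V → V → Prop), P (forestClass r))
    (a : ForestClass) : P a :=
  Quotient.ind (fun F => h F.V F.parent) a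

/-- Disjoint union of forests. -/
instance : Add ForestClass where
  add := Quotient.map₂ (fun F G => ⟨F.V ⊕ G.V, Sum.LiftRel F.parent G.parent⟩) (by
    rintro F F' ⟨e⟩ G G' ⟨f⟩
    refine ⟨⟨Equiv.sumCongr e.toEquiv f.toEquiv, ?_⟩⟩
    rintro (a | a) (b | b) <;> simp [e.map_rel_iff, f.map_rel_iff])

/-- The empty forest. -/
instance : Zero ForestClass where
  zero := forestClass (V := Empty) (fun _ _ => False)

theorem forestClass_add {V W : Type} (r : V → V → Prop) (s : W → W → Prop) :
    forestClass r + forestClass s = forestClass (Sum.LiftRel r s) := rfl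

theorem zero_def : (0 : ForestClass) = forestClass (V := Empty) (fun _ _ => False) := rfl

theorem forestClass_of_isEmpty {V : Type} [IsEmpty V] (r : V → V → Prop) : forestClass r = 0 :=
  forestClass_eq_iff.2 ⟨⟨Equiv.equivOfIsEmpty _ _, fun {a} => isEmptyElim a⟩⟩

instance : AddCommMonoid ForestClass where
  add_assoc a b c := by
    induction a using ind with | h U r
    induction b using ind with | h V s
    induction c using ind with | h W t
    simp only [forestClass_add]
    refine forestClass_eq_iff.2 ⟨⟨Equiv.sumAssoc U V W, ?_⟩⟩
    rintro ((a | a) | a) ((b | b) | b) <;> simp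
  zero_add a := by
    induction a using ind with | h U r
    rw [zero_def, forestClass_add]
    refine forestClass_eq_iff.2 ⟨⟨Equiv.emptySum Empty U, ?_⟩⟩
    rintro (a | a) (b | b) <;> first | exact a.elim | exact b.elim | simp
  add_zero a := by
    induction a using ind with | h U r
    rw [zero_def, forestClass_add]
    refine forestClass_eq_iff.2 ⟨⟨Equiv.sumEmpty U Empty, ?_⟩⟩
    rintro (a | a) (b | b) <;> first | exact a.elim | exact b.elim | simp
  add_comm a b := by
    induction a using ind with | h U r
    induction b using ind with | h V s
    simp only [forestClass_add]
    refine forestClass_eq_iff.2 ⟨⟨Equiv.sumComm U V, ?_⟩⟩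
    rintro (a | a) (b | b) <;> simp
  nsmul := nsmulRec

/-- The tree obtained from a forest by joining its roots to a new root. -/
def cone : ForestClass → ForestClass :=
  Quotient.map (fun F => ⟨Option F.V, coneRel F.parent⟩) (by
    rintro F G ⟨e⟩
    refine ⟨⟨Equiv.optionCongr e.toEquiv, ?_⟩⟩
    rintro (_ | a) (_ | b)
    · simp [coneRel]
    · simp [coneRel]
    · simp only [coneRel, Equiv.optionCongr_apply, Option.map_some, Option.map_none]
      exact ⟨fun h y hy => h (e y) (e.map_rel_iff.2 hy), fun h y hy =>
        h (e.symm y) (by rw [← e.map_rel_iff]; simpa using hy)⟩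
    · simp [coneRel, e.map_rel_iff])

theorem cone_forestClass {V : Type} (r : V → V → Prop) :
    cone (forestClass r) = forestClass (coneRel r) := rfl

end ForestClass

open ForestClass

/-! ### Rooted forests and their trees -/

/-- The restriction of a relation to a set of vertices. -/
def restrictRel {V : Type} (r : V → V → Prop) (s : Set V) : s → s → Prop := fun x y => r x y

theorem forestClass_restrict_union {V : Type} {r : V → V → Prop} {s t : Set V}
    (hst : Disjoint s t) (h₁ : ∀ x ∈ s, ∀ y ∈ t, ¬ r x y) (h₂ : ∀ x ∈ t, ∀ y ∈ s, ¬ r x y) :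
    forestClass (restrictRel r (s ∪ t)) =
      forestClass (restrictRel r s) + forestClass (restrictRel r t) := by
  classical
  rw [forestClass_add]
  refine forestClass_eq_iff.2 (Nonempty.map RelIso.symm ⟨⟨(Equiv.Set.union hst).symm, ?_⟩⟩)
  rintro (⟨a, ha⟩ | ⟨a, ha⟩) (⟨b, hb⟩ | ⟨b, hb⟩) <;>
    simp [restrictRel, h₁, h₂, ha, hb]

theorem forestClass_restrict_univ {V : Type} (r : V → V → Prop) :
    forestClass (restrictRel r Set.univ) = forestClass r :=
  forestClass_eq_iff.2 ⟨⟨Equiv.Set.univ V, Iff.rfl⟩⟩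

theorem forestClass_eq_restrict_add_compl {V : Type} {r : V → V → Prop} {s : Set V}
    (h : ∀ x y, r x y → (x ∈ s ↔ y ∈ s)) :
    forestClass r = forestClass (restrictRel r s) + forestClass (restrictRel r sᶜ) := by
  rw [← forestClass_restrict_union disjoint_compl_right, Set.union_compl_self,
    forestClass_restrict_univ]
  · exact fun x hx y hy hr => hy ((h x y hr).1 hx)
  · exact fun x hx y hy hr => hx ((h x y hr).2 hy)

/-- A relation is the parent relation of a rooted forest when parents are unique and no vertex has
an infinite chain of ancestors. -/
structure IsForest {V : Type} (r : V → V → Prop) : Prop where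
  wf : WellFounded (Function.swap r)
  unique : ∀ {x y z}, r x y → r x z → y = z

theorem IsForest.restrict {V : Type} {r : V → V → Prop} (h : IsForest r) (s : Set V) :
    IsForest (restrictRel r s) where
  wf := InvImage.wf (Subtype.val) h.wf
  unique h₁ h₂ := Subtype.ext (h.unique h₁ h₂)

/-- A root of a forest is a vertex without a parent. -/
def IsRoot {V : Type} (r : V → V → Prop) (x : V) : Prop := ∀ y, ¬ r x y

namespace IsForest

variable {V : Type} {r : V → V → Prop}

open Classical in
/-- The root of the tree containing a given vertex. -/
noncomputable def root (h : IsForest r) : V → V :=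
  h.wf.fix (fun x ih => if hx : ∃ y, r x y then ih hx.choose hx.choose_spec else x)

theorem root_of_parent (h : IsForest r) {x y : V} (hxy : r x y) : h.root x = h.root y := by
  have hx : ∃ y, r x y := ⟨y, hxy⟩
  rw [root, WellFounded.fix_eq, dif_pos hx]
  exact congrArg h.root (h.unique hx.choose_spec hxy)

theorem root_of_isRoot (h : IsForest r) {x : V} (hx : IsRoot r x) : h.root x = x := by
  rw [root, WellFounded.fix_eq, dif_neg (by simpa [IsRoot] using hx)]

theorem isRoot_root (h : IsForest r) (x : V) : IsRoot r (h.root x) := by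
  induction x using h.wf.induction with | h x ih
  by_cases hx : ∃ y, r x y
  · obtain ⟨y, hy⟩ := hx
    rw [h.root_of_parent hy]
    exact ih y hy
  · have hx' : IsRoot r x := by simpa [IsRoot] using hx
    rwa [h.root_of_isRoot hx']

theorem root_map (h : IsForest r) (e : r ≃r r) (x : V) : h.root (e x) = e (h.root x) := by
  induction x using h.wf.induction with | h x ih
  by_cases hx : ∃ y, r x y
  · obtain ⟨y, hy⟩ := hx
    rw [h.root_of_parent hy, h.root_of_parent (e.map_rel_iff.2 hy), ih y hy]
  · have hx' : IsRoot r x := by simpa [IsRoot] using hx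
    rw [h.root_of_isRoot hx', h.root_of_isRoot]
    intro y hy
    exact hx' (e.symm y) (by rw [← e.map_rel_iff]; simpa using hy)

/-- The vertices of the tree with root `o`. -/
def treeAt (h : IsForest r) (o : V) : Set V := {x | h.root x = o}

/-- The vertices other than the root of the tree with root `o`. -/
def below (h : IsForest r) (o : V) : Set V := {x | h.root x = o ∧ x ≠ o}

/-- The tree at a root `o` is the cone over the forest of the vertices below `o`. -/
theorem forestClass_treeAt (h : IsForest r) {o : V} (ho : IsRoot r o) :
    forestClass (restrictRel r (h.treeAt o)) =
      cone (forestClass (restrictRel r (h.below o))) := by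
  classical
  rw [cone_forestClass]
  let f : Option (h.below o) → h.treeAt o
    | none => ⟨o, h.root_of_isRoot ho⟩
    | some x => ⟨x, x.2.1⟩
  have hf : Function.Bijective f := by
    constructor
    · rintro (_ | ⟨a, ha⟩) (_ | ⟨b, hb⟩) hab
      · rfl
      · exact absurd (congrArg Subtype.val hab).symm hb.2
      · exact absurd (congrArg Subtype.val hab) ha.2
      · exact congrArg some (Subtype.ext (congrArg (fun z : h.treeAt o => (z : V)) hab))
    · rintro ⟨x, hx⟩
      by_cases hxo : x = o
      · exact ⟨none, Subtype.ext hxo.symm⟩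
      · exact ⟨some ⟨x, hx, hxo⟩, rfl⟩
  refine forestClass_eq_iff.2 (Nonempty.map RelIso.symm ⟨⟨Equiv.ofBijective f hf, ?_⟩⟩)
  rintro (_ | ⟨a, ha⟩) (_ | ⟨b, hb⟩)
  · simpa [coneRel, restrictRel, f] using ho o
  · simpa [coneRel, restrictRel, f] using ho b
  · simp only [coneRel, restrictRel, f, Equiv.ofBijective_apply]
    constructor
    · rintro hr ⟨y, hy⟩ hay
      exact hy.2 (h.unique hay hr)
    · intro hr
      by_cases hx : ∃ y, r a y
      · obtain ⟨y, hy⟩ := hx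
        have hyo : h.root y = o := by rw [← h.root_of_parent hy]; exact ha.1
        by_contra hne
        exact hr ⟨y, hyo, fun he => hne (he ▸ hy)⟩ hy
      · have hx' : IsRoot r a := by simpa [IsRoot] using hx
        exact absurd ((h.root_of_isRoot hx').symm.trans ha.1) ha.2
  · rfl

/-- A forest is the disjoint union of the trees at its roots. -/
theorem forestClass_preimage_root (h : IsForest r) (O : Finset V) :
    forestClass (restrictRel r {x | h.root x ∈ O}) =
      ∑ o ∈ O, forestClass (restrictRel r (h.treeAt o)) := by
  classical
  induction O using Finset.induction_on with
  | empty =>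
    have : IsEmpty {x | h.root x ∈ (∅ : Finset V)} := ⟨fun x => by simpa using x.2⟩
    rw [forestClass_of_isEmpty, Finset.sum_empty]
  | insert o O ho ih =>
    rw [Finset.sum_insert ho, ← ih, ← forestClass_restrict_union]
    · congr 2
      all_goals (ext x; simp [treeAt])
    · rw [Set.disjoint_left]
      rintro x hx hx'
      exact ho (hx ▸ hx')
    · rintro x hx y hy hr
      exact ho (hx ▸ h.root_of_parent hr ▸ hy)
    · rintro x hx y hy hr
      refine ho (hy ▸ ?_)
      rw [← h.root_of_parent hr]
      exact hx

end IsForest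

/-! ### Codes for forests -/

/-- The forest encoded by a binary tree: the left child of a node encodes the forest below the first
root, the right child encodes the remaining trees. -/
def treeClass : BinaryTree Unit → ForestClass
  | .nil => 0
  | .node _ a b => cone (treeClass a) + treeClass b

theorem exists_treeClass_add (s t : BinaryTree Unit) :
    ∃ u, treeClass u = treeClass s + treeClass t ∧ u.numNodes = s.numNodes + t.numNodes := by
  induction s with
  | nil => exact ⟨t, by simp [treeClass]⟩
  | node v a b _ ihb =>
    obtain ⟨u, hu, hc⟩ := ihb
    refine ⟨.node v a u, ?_, ?_⟩
    · rw [treeClass, treeClass, hu, add_assoc]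
    · simp only [BinaryTree.numNodes, hc]
      ring

theorem exists_treeClass_nsmul_add (m : ℕ) (s t : BinaryTree Unit) :
    ∃ u, treeClass u = m • treeClass s + treeClass t ∧
      u.numNodes = m * s.numNodes + t.numNodes := by
  induction m with
  | zero => exact ⟨t, by simp⟩
  | succ m ih =>
    obtain ⟨u, hu, hc⟩ := ih
    obtain ⟨w, hw, hd⟩ := exists_treeClass_add s u
    refine ⟨w, ?_, ?_⟩
    · rw [hw, hu, succ_nsmul, ← add_assoc, add_comm (treeClass s)]
    · rw [hd, hc]
      ring

namespace IsForest

variable {V : Type} {r : V → V → Prop}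

theorem mem_treeAt_iff (h : IsForest r) (o : V) {x y : V} (hxy : r x y) :
    x ∈ h.treeAt o ↔ y ∈ h.treeAt o := by
  simp only [treeAt, Set.mem_ofPred_eq, h.root_of_parent hxy]

theorem treeAt_eq_insert (h : IsForest r) {o : V} (ho : IsRoot r o) :
    h.treeAt o = insert o (h.below o) := by
  ext x
  by_cases hx : x = o
  · subst hx
    simp [treeAt, h.root_of_isRoot ho]
  · simp [treeAt, below, hx]

theorem ncard_treeAt [Finite V] (h : IsForest r) {o : V} (ho : IsRoot r o) :
    (h.treeAt o).ncard = (h.below o).ncard + 1 := by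
  rw [h.treeAt_eq_insert ho, Set.ncard_insert_of_notMem fun hm => hm.2 rfl]

/-- A forest is the tree at any of its roots together with the remaining trees. -/
theorem forestClass_eq_cone_add (h : IsForest r) {o : V} (ho : IsRoot r o) :
    forestClass r = cone (forestClass (restrictRel r (h.below o))) +
      forestClass (restrictRel r (h.treeAt o)ᶜ) := by
  rw [forestClass_eq_restrict_add_compl (s := h.treeAt o) (fun _ _ => h.mem_treeAt_iff o),
    h.forestClass_treeAt ho]

theorem ncard_below_add [Finite V] (h : IsForest r) {o : V} (ho : IsRoot r o) :
    (h.below o).ncard + 1 + ((h.treeAt o)ᶜ).ncard = Nat.card V := by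
  rw [← h.ncard_treeAt ho, Set.ncard_add_ncard_compl]

/-- Every finite forest is encoded by a binary tree with as many nodes as the forest has vertices.
The first root is split off, and the two remaining parts are encoded separately. -/
theorem exists_treeClass [Finite V] (h : IsForest r) :
    ∃ t, treeClass t = forestClass r ∧ t.numNodes = Nat.card V := by
  induction hn : Nat.card V using Nat.strong_induction_on generalizing V with | _ n ih
  subst hn
  rcases isEmpty_or_nonempty V with hV | ⟨⟨x⟩⟩
  · exact ⟨.nil, by rw [forestClass_of_isEmpty]; rfl, by simp⟩
  · have ho := h.isRoot_root x
    have hc := h.ncard_below_add ho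
    obtain ⟨a, ha, ha'⟩ := ih (Nat.card (h.below (h.root x)))
      (by rw [Nat.card_coe_set_eq]; omega) (h.restrict _) rfl
    obtain ⟨b, hb, hb'⟩ := ih (Nat.card ↥(h.treeAt (h.root x))ᶜ)
      (by rw [Nat.card_coe_set_eq]; omega) (h.restrict _) rfl
    rw [Nat.card_coe_set_eq] at ha' hb'
    refine ⟨.node () a b, ?_, ?_⟩
    · rw [treeClass, ha, hb, ← h.forestClass_eq_cone_add ho]
    · rw [BinaryTree.numNodes]
      omega

end IsForest

/-! ### Codes for forests with few fixed vertices -/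

/-- The vertices that are fixed by every automorphism of a relation. -/
def fixedSet {V : Type} (r : V → V → Prop) : Set V := {x | ∀ e : r ≃r r, e x = x}

/-- Automorphisms restrict to an invariant set, so a vertex that is fixed by all automorphisms of the
restriction is fixed by all automorphisms. -/
theorem ncard_fixedSet_restrict_le {V : Type} [Finite V] {r : V → V → Prop} {s : Set V}
    (hs : ∀ (e : r ≃r r) (x : V), x ∈ s ↔ e x ∈ s) :
    (fixedSet (restrictRel r s)).ncard ≤ (fixedSet r ∩ s).ncard := by
  rw [← Set.ncard_image_of_injective _ Subtype.val_injective]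
  refine Set.ncard_le_ncard ?_ (Set.toFinite _)
  rintro _ ⟨x, hx, rfl⟩
  refine ⟨fun e => ?_, x.2⟩
  exact congrArg Subtype.val
    (hx ⟨e.toEquiv.subtypeEquiv (hs e), fun {a b} => e.map_rel_iff (a := (a : V)) (b := b)⟩)

/-- The forest encoded by a binary tree when the fixed vertices of the forest are marked: a node
whose children are the nodes `(d, e)` and `(c, b)` encodes a fixed root, below which two copies of
the forest `d`, three copies of the forest `e` and the forest with marked vertices `c` are found,
followed by the forest with marked vertices `b`. Binary trees of another shape encode nothing. -/
def coreClass : BinaryTree Unit → ForestClass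
  | .node _ (.node _ d e) (.node _ c b) =>
    cone (2 • treeClass d + 3 • treeClass e + coreClass c) + coreClass b
  | _ => 0

namespace IsForest

variable {V : Type} {r : V → V → Prop}

theorem map_mem_treeAt_iff (h : IsForest r) (e : r ≃r r) (o x : V) :
    x ∈ h.treeAt o ↔ e x ∈ h.treeAt (e o) := by
  simp [treeAt, h.root_map]

theorem forestClass_treeAt_map (h : IsForest r) (e : r ≃r r) (o : V) :
    forestClass (restrictRel r (h.treeAt (e o))) = forestClass (restrictRel r (h.treeAt o)) :=
  (forestClass_eq_iff.2 ⟨⟨e.toEquiv.subtypeEquiv (h.map_mem_treeAt_iff e o),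
    fun {a b} => e.map_rel_iff (a := (a : V)) (b := b)⟩⟩).symm

theorem ncard_treeAt_map (h : IsForest r) (e : r ≃r r) (o : V) :
    (h.treeAt (e o)).ncard = (h.treeAt o).ncard := by
  rw [← Set.ncard_image_of_injective (h.treeAt o) e.injective]
  congr 1
  ext y
  obtain ⟨x, rfl⟩ := e.surjective y
  rw [← h.map_mem_treeAt_iff, e.injective.mem_set_image]

theorem ncard_preimage_root [Finite V] (h : IsForest r) (O : Finset V) :
    {x | h.root x ∈ O}.ncard = ∑ o ∈ O, (h.treeAt o).ncard := by
  classical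
  have := Fintype.ofFinite V
  have hO : {x | h.root x ∈ O} =
      ((Finset.univ.filter fun x => h.root x ∈ O : Finset V) : Set V) := by
    ext; simp
  rw [hO, Set.ncard_coe_finset,
    Finset.card_eq_sum_card_fiberwise (f := h.root) (t := O) (by intro x; simp)]
  refine Finset.sum_congr rfl fun o ho => ?_
  rw [← Set.ncard_coe_finset]
  congr 1
  ext x
  simp only [treeAt, Finset.coe_filter, Finset.mem_filter, Finset.mem_univ, true_and,
    Set.mem_ofPred_eq]
  exact ⟨fun hx => hx.2, fun hx => ⟨hx ▸ ho, hx⟩⟩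

/-- A forest with few fixed vertices has a short code. The trees at the roots of one orbit of the
automorphism group are isomorphic. If the orbit has at least two elements, these trees are counted
by the doubled and the tripled forest; if it consists of a fixed root, the forest below that root
is encoded recursively. -/
theorem exists_core [Finite V] (h : IsForest r) :
    ∃ d e c, forestClass r = 2 • treeClass d + 3 • treeClass e + coreClass c ∧
      2 * (d.numNodes + e.numNodes + c.numNodes) ≤ Nat.card V + 5 * (fixedSet r).ncard := by
  classical
  induction hn : Nat.card V using Nat.strong_induction_on generalizing V with | _ n ih
  subst hn
  rcases isEmpty_or_nonempty V with hV | ⟨⟨x⟩⟩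
  · exact ⟨.nil, .nil, .nil, by simp [forestClass_of_isEmpty, treeClass, coreClass], by simp⟩
  obtain ⟨o, ho⟩ : ∃ o, IsRoot r o := ⟨_, h.isRoot_root x⟩
  by_cases hfix : ∀ e : r ≃r r, e o = o
  · -- The root `o` is fixed: the tree at `o` is invariant, and so is the forest below `o`.
    have hc := h.ncard_below_add ho
    have hA : ∀ (e : r ≃r r) (x : V), x ∈ h.treeAt o ↔ e x ∈ h.treeAt o := fun e x => by
      rw [h.map_mem_treeAt_iff e, hfix e]
    have hB : ∀ (e : r ≃r r) (x : V), x ∈ h.below o ↔ e x ∈ h.below o := fun e x => by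
      have hxo : e x = o ↔ x = o := by rw [← e.injective.eq_iff (a := x), hfix e]
      have := hA e x
      simp only [treeAt, below, Set.mem_ofPred_eq, ne_eq, hxo] at this ⊢
      rw [this]
    obtain ⟨d, e, c, h₁, h₁'⟩ := ih (Nat.card (h.below o))
      (by rw [Nat.card_coe_set_eq]; omega) (h.restrict _) rfl
    obtain ⟨d', e', c', h₂, h₂'⟩ := ih (Nat.card ↥(h.treeAt o)ᶜ)
      (by rw [Nat.card_coe_set_eq]; omega) (h.restrict _) rfl
    refine ⟨d', e', .node () (.node () d e) (.node () c c'), ?_, ?_⟩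
    · rw [h.forestClass_eq_cone_add ho, h₁, h₂, coreClass]
      abel
    · have hf₁ := ncard_fixedSet_restrict_le hB
      have hf₂ := ncard_fixedSet_restrict_le (s := (h.treeAt o)ᶜ) (fun e x => not_congr (hA e x))
      have hf₃ : (fixedSet r ∩ h.treeAt o).ncard = (fixedSet r ∩ h.below o).ncard + 1 := by
        rw [h.treeAt_eq_insert ho, Set.inter_insert_of_mem (show o ∈ fixedSet r from hfix),
          Set.ncard_insert_of_notMem fun hm => hm.2.2 rfl]
      have hf₄ := Set.ncard_inter_add_ncard_sdiff_eq_ncard (fixedSet r) (h.treeAt o)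
      rw [Set.sdiff_eq] at hf₄
      rw [Nat.card_coe_set_eq] at h₁' h₂'
      simp only [BinaryTree.numNodes]
      omega
  · -- The root `o` is not fixed: all trees at the roots in its orbit `O` are split off together.
    push Not at hfix
    obtain ⟨e₀, he₀⟩ := hfix
    let O : Finset V := (Set.toFinite {y | ∃ e : r ≃r r, e o = y}).toFinset
    have hO : ∀ y, y ∈ O ↔ ∃ e : r ≃r r, e o = y := fun y => by simp [O]
    let s : Set V := {x | h.root x ∈ O}
    have hs : ∀ x y, r x y → (x ∈ s ↔ y ∈ s) := fun x y hxy => by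
      simp only [s, Set.mem_ofPred_eq, h.root_of_parent hxy]
    have hinv : ∀ (e : r ≃r r) (x : V), x ∈ s ↔ e x ∈ s := fun e x => by
      simp only [s, Set.mem_ofPred_eq, h.root_map, hO]
      constructor
      · rintro ⟨f, hf⟩
        exact ⟨f.trans e, by simp [hf]⟩
      · rintro ⟨f, hf⟩
        exact ⟨f.trans e.symm, by simp [hf]⟩
    have hOcard : 2 ≤ O.card := by
      rw [← Finset.card_pair he₀]
      refine Finset.card_le_card fun y hy => (hO y).2 ?_
      rcases Finset.mem_insert.1 hy with rfl | hy
      · exact ⟨e₀, rfl⟩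
      · exact ⟨RelIso.refl _, (Finset.mem_singleton.1 hy).symm⟩
    obtain ⟨t, ht, ht'⟩ := (h.restrict (h.treeAt o)).exists_treeClass
    rw [Nat.card_coe_set_eq] at ht'
    have hsclass : forestClass (restrictRel r s) = O.card • treeClass t := by
      rw [h.forestClass_preimage_root, ht]
      refine Finset.sum_eq_card_nsmul fun y hy => ?_
      obtain ⟨e, rfl⟩ := (hO y).1 hy
      exact h.forestClass_treeAt_map e o
    have hscard : s.ncard = O.card * t.numNodes := by
      rw [h.ncard_preimage_root, ht', ← smul_eq_mul]
      refine Finset.sum_eq_card_nsmul fun y hy => ?_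
      obtain ⟨e, rfl⟩ := (hO y).1 hy
      exact h.ncard_treeAt_map e o
    have hcompl := Set.ncard_add_ncard_compl s
    have hspos : 0 < s.ncard := by
      rw [Set.ncard_pos]
      exact ⟨o, (hO _).2 ⟨RelIso.refl _, (h.root_of_isRoot ho).symm⟩⟩
    obtain ⟨d, e, c, h₁, h₁'⟩ := ih (Nat.card ↥sᶜ)
      (by rw [Nat.card_coe_set_eq]; omega) (h.restrict _) rfl
    rw [Nat.card_coe_set_eq] at h₁'
    -- Every multiplicity `m ≥ 2` has this form, and recording `a + b` copies of the tree costs at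
    -- most half of the `m` copies that are present.
    obtain ⟨a, b, hab⟩ : ∃ a b, O.card = 2 * a + 3 * b :=
      ⟨(O.card - 3 * (O.card % 2)) / 2, O.card % 2, by omega⟩
    obtain ⟨d', hd, hd'⟩ := exists_treeClass_nsmul_add a t d
    obtain ⟨e', he, he'⟩ := exists_treeClass_nsmul_add b t e
    refine ⟨d', e', c, ?_, ?_⟩
    · rw [forestClass_eq_restrict_add_compl hs, hsclass, h₁, hd, he, hab, add_nsmul, mul_nsmul',
        mul_nsmul', nsmul_add, nsmul_add]
      abel
    · have hf := (ncard_fixedSet_restrict_le (s := sᶜ) fun e x => not_congr (hinv e x)).trans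
        (Set.ncard_le_ncard Set.inter_subset_left (Set.toFinite _))
      rw [hab] at hscard
      rw [hd', he']
      nlinarith

end IsForest

/-! ### The centre of a tree -/

namespace SimpleGraph

variable {V : Type} {G : SimpleGraph V}

/-- Two shortest paths from `z` to `y` and `y'`, prolonged to `x`, are paths from `z` to `x` and hence
equal. -/
theorem IsTree.eq_of_adj_of_dist_lt (hG : G.IsTree) {z x y y' : V} (hy : G.Adj x y)
    (hy' : G.Adj x y') (h : G.dist z y < G.dist z x) (h' : G.dist z y' < G.dist z x) : y = y' := by
  have key : ∀ w (hw : G.Adj x w), G.dist z w < G.dist z x →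
      ∃ p : G.Walk z x, p.IsPath ∧ p.penultimate = w := by
    intro w hw hlt
    obtain ⟨p, hp⟩ := hG.connected.exists_walk_length_eq_dist z w
    refine ⟨p.concat hw.symm, Walk.isPath_of_length_eq_dist _ ?_, Walk.penultimate_concat _ _⟩
    have h₁ := hG.dist_eq_dist_add_one_of_adj z hw
    rw [Walk.length_concat, hp]
    omega
  obtain ⟨p, hp, rfl⟩ := key y hy h
  obtain ⟨q, hq, rfl⟩ := key y' hy' h'
  rw [(hG.existsUnique_path z x).unique hp hq]

/-- The sum of the distances from all vertices to `v`. -/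
noncomputable def distSum [Fintype V] (G : SimpleGraph V) (v : V) : ℕ := ∑ u, G.dist u v

theorem Iso.dist_map {W : Type} {H : SimpleGraph W} (e : G ≃g H) (hG : G.Connected) (u v : V) :
    H.dist (e u) (e v) = G.dist u v := by
  have hH : H.Connected := e.connected_iff.1 hG
  apply le_antisymm
  · obtain ⟨p, hp⟩ := hG.exists_walk_length_eq_dist u v
    rw [← hp, ← Walk.length_map e.toHom p]
    exact dist_le _
  · obtain ⟨p, hp⟩ := hH.exists_walk_length_eq_dist (e u) (e v)
    rw [← hp, ← Walk.length_map e.symm.toHom p]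
    simpa using dist_le (p.map e.symm.toHom)

theorem distSum_map [Fintype V] (hG : G.Connected) (e : G ≃g G) (v : V) :
    G.distSum (e v) = G.distSum v := by
  unfold distSum
  rw [← Equiv.sum_comp e.toEquiv]
  exact Finset.sum_congr rfl fun u _ => e.dist_map hG u v

/-- If the distance sum does not increase from `x` to its neighbour `y`, at least half of the
vertices are closer to `y` than to `x`. -/
theorem IsTree.card_le_of_distSum_le [Fintype V] (hG : G.IsTree) {x y : V} (h : G.Adj x y)
    (hS : G.distSum y ≤ G.distSum x) :
    Fintype.card V ≤ 2 * (Finset.univ.filter fun z => G.dist z y < G.dist z x).card := by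
  have h₁ : G.distSum y + (Finset.univ.filter fun z => G.dist z y < G.dist z x).card =
      G.distSum x + (Finset.univ.filter fun z => ¬ G.dist z y < G.dist z x).card := by
    simp only [distSum, Finset.card_filter, ← Finset.sum_add_distrib]
    refine Finset.sum_congr rfl fun z _ => ?_
    have := hG.dist_eq_dist_add_one_of_adj z h
    split_ifs <;> omega
  have h₂ := Finset.card_filter_add_card_filter_not (s := (Finset.univ : Finset V))
    (fun z => G.dist z y < G.dist z x)
  rw [Finset.card_univ] at h₂
  omega

/-- A vertex `x` has at most one neighbour with a distance sum not larger than its own: the vertices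
that are closer to such a neighbour are at least half of all vertices, the sets for two neighbours
are disjoint, and `x` belongs to neither. -/
theorem IsTree.eq_of_distSum_le [Fintype V] (hG : G.IsTree) {x y y' : V} (hy : G.Adj x y)
    (hy' : G.Adj x y') (h : G.distSum y ≤ G.distSum x) (h' : G.distSum y' ≤ G.distSum x) :
    y = y' := by
  classical
  by_contra hne
  have h₁ := hG.card_le_of_distSum_le hy h
  have h₂ := hG.card_le_of_distSum_le hy' h'
  have hdisj : Disjoint (Finset.univ.filter fun z => G.dist z y < G.dist z x)
      (Finset.univ.filter fun z => G.dist z y' < G.dist z x) := by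
    rw [Finset.disjoint_left]
    intro z hz hz'
    simp only [Finset.mem_filter, Finset.mem_univ, true_and] at hz hz'
    exact hne (hG.eq_of_adj_of_dist_lt hy hy' hz hz')
  have h₃ := Finset.card_union_of_disjoint hdisj
  have h₄ : ((Finset.univ.filter fun z => G.dist z y < G.dist z x) ∪
      (Finset.univ.filter fun z => G.dist z y' < G.dist z x)).card < Fintype.card V := by
    refine Finset.card_lt_univ_of_notMem (x := x) ?_
    simp
  omega

/-- The parent of a vertex is its neighbour with a smaller distance sum. The roots of this relation
are the centroids of the tree: one vertex or two adjacent ones. -/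
def centralParent [Fintype V] (G : SimpleGraph V) (x y : V) : Prop :=
  G.Adj x y ∧ G.distSum y < G.distSum x

theorem IsTree.isForest_centralParent [Fintype V] (hG : G.IsTree) : IsForest G.centralParent where
  wf := Subrelation.wf (fun h => h.2) (InvImage.wf G.distSum Nat.lt_wfRel.wf)
  unique h h' := hG.eq_of_distSum_le h.1 h'.1 h.2.le h'.2.le

/-- The distance sum increases along a path that starts at a root, except perhaps in its first
step. -/
theorem IsTree.distSum_le_of_isRoot [Fintype V] (hG : G.IsTree) {x : V}
    (hx : IsRoot G.centralParent x) {z w : V} (hzw : G.Adj z w) (hd : G.dist x w < G.dist x z) :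
    G.distSum w ≤ G.distSum z ∧ (w ≠ x → G.distSum w < G.distSum z) := by
  induction hn : G.dist x w generalizing z w with
  | zero =>
    have hxw : x = w := hG.connected.dist_eq_zero_iff.1 hn
    subst hxw
    refine ⟨?_, fun h => absurd rfl h⟩
    by_contra hlt
    exact hx z ⟨hzw.symm, not_le.1 hlt⟩
  | succ n ih =>
    obtain ⟨p, hp⟩ := hG.connected.exists_walk_length_eq_dist w x
    cases p with
    | nil => simp at hn
    | cons hwu p =>
      rename_i u
      rw [Walk.length_cons, dist_comm, hn] at hp
      have hu : G.dist x u ≤ p.length := by rw [dist_comm]; exact dist_le p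
      have h₁ := hG.dist_eq_dist_add_one_of_adj x hwu
      have hS := (ih hwu (by omega) (by omega)).1
      have hlt : G.distSum w < G.distSum z := by
        by_contra hle
        have := hG.eq_of_distSum_le hwu hzw.symm hS (not_lt.1 hle)
        subst this
        omega
      exact ⟨hlt.le, fun _ => hlt⟩

/-- Any two roots are adjacent: otherwise the path between them would reach the second root from a
vertex with a smaller distance sum. -/
theorem IsTree.adj_of_isRoot [Fintype V] (hG : G.IsTree) {x y : V}
    (hx : IsRoot G.centralParent x) (hy : IsRoot G.centralParent y) (hne : x ≠ y) : G.Adj x y := by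
  obtain ⟨p, hp⟩ := hG.connected.exists_walk_length_eq_dist y x
  cases p with
  | nil => exact absurd rfl hne
  | cons hyu p =>
    rename_i u
    rw [Walk.length_cons, dist_comm] at hp
    have hu : G.dist x u ≤ p.length := by rw [dist_comm]; exact dist_le p
    by_cases hux : u = x
    · exact hux ▸ hyu.symm
    · exact absurd ⟨hyu, (hG.distSum_le_of_isRoot hx hyu (by omega)).2 hux⟩ (hy u)

/-- A tree is determined by the forest of its central parents: the remaining edges join roots. -/
theorem IsTree.adj_iff_centralParent [Fintype V] (hG : G.IsTree) (x y : V) :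
    G.Adj x y ↔ G.centralParent x y ∨ G.centralParent y x ∨
      (x ≠ y ∧ IsRoot G.centralParent x ∧ IsRoot G.centralParent y) := by
  constructor
  · intro h
    rcases lt_trichotomy (G.distSum x) (G.distSum y) with hlt | heq | hgt
    · exact Or.inr (Or.inl ⟨h.symm, hlt⟩)
    · refine Or.inr (Or.inr ⟨h.ne, fun z hz => ?_, fun z hz => ?_⟩)
      · rw [hG.eq_of_distSum_le hz.1 h hz.2.le heq.ge] at hz
        exact hz.2.ne heq.symm
      · rw [hG.eq_of_distSum_le hz.1 h.symm hz.2.le heq.le] at hz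
        exact hz.2.ne heq
    · exact Or.inl ⟨h, hgt⟩
  · rintro (h | h | ⟨hne, hx, hy⟩)
    · exact h.1
    · exact h.1.symm
    · exact hG.adj_of_isRoot hx hy hne

theorem nonempty_iso_of_centralParent [Fintype V] {W : Type} [Fintype W] {H : SimpleGraph W}
    (hG : G.IsTree) (hH : H.IsTree) (e : G.centralParent ≃r H.centralParent) :
    Nonempty (G ≃g H) := by
  have hroot : ∀ x, IsRoot H.centralParent (e x) ↔ IsRoot G.centralParent x := fun x =>
    ⟨fun h y hy => h (e y) (e.map_rel_iff.2 hy), fun h y hy =>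
      h (e.symm y) (by rw [← e.map_rel_iff]; simpa using hy)⟩
  refine ⟨⟨e.toEquiv, fun {a b} => ?_⟩⟩
  rw [hG.adj_iff_centralParent, hH.adj_iff_centralParent]
  simp [hroot, e.map_rel_iff]

/-- Automorphisms of a tree preserve distance sums and hence central parents. -/
theorem ncard_fixedSet_centralParent_le [Fintype V] (hG : G.IsTree) :
    (fixedSet G.centralParent).ncard ≤ fixedVertexCount G := by
  refine Set.ncard_le_ncard (fun x hx => ?_) (Set.toFinite _)
  refine (isFixedVertex_iff G x).2 fun φ => hx ⟨φ.toEquiv, fun {a b} => ?_⟩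
  have h₁ := distSum_map hG.connected φ a
  have h₂ := distSum_map hG.connected φ b
  change G.Adj (φ a) (φ b) ∧ G.distSum (φ b) < G.distSum (φ a) ↔ _
  rw [φ.map_adj_iff, h₁, h₂, centralParent]

end SimpleGraph

/-! ### Counting trees with few fixed vertices -/

/-- The Catalan numbers of index at most `N` have a sum of at most `4 ^ (N + 1)`. -/
theorem card_trees_numNodes_le (N : ℕ) :
    Nat.card {t : BinaryTree Unit // t.numNodes ≤ N} ≤ 4 ^ (N + 1) ∧
      Finite {t : BinaryTree Unit // t.numNodes ≤ N} := by
  classical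
  let A : Finset (BinaryTree Unit) :=
    (Finset.range (N + 1)).biUnion fun i => BinaryTree.treesOfNumNodesEq i
  have hA : ∀ t : BinaryTree Unit, t.numNodes ≤ N ↔ t ∈ A := fun t => by
    simp [A, BinaryTree.mem_treesOfNumNodesEq]
  have hcard : A.card ≤ 4 ^ (N + 1) := by
    refine Finset.card_biUnion_le.trans ((Finset.sum_le_sum (g := fun i => 4 ^ i)
      fun i _ => ?_).trans (Nat.geomSum_lt (by norm_num) (by simp)).le)
    rw [BinaryTree.treesOfNumNodesEq_card_eq_catalan, catalan_eq_centralBinom_div]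
    refine (Nat.div_le_self _ _).trans ?_
    rw [Nat.centralBinom, show 4 = 2 ^ 2 by norm_num, ← pow_mul]
    exact Nat.choose_le_two_pow _ _
  have e : {t : BinaryTree Unit // t.numNodes ≤ N} ≃ A := Equiv.subtypeEquivRight hA
  refine ⟨?_, Finite.of_equiv _ e.symm⟩
  rw [Nat.card_congr e, Nat.card_eq_fintype_card, Fintype.card_coe]
  exact hcard

/-- There are few trees with at most `k` fixed vertices: the code of the forest of central parents
determines the tree. -/
theorem card_fixedVertexCount_le (n k : ℕ) :
    Nat.card {T : UnlabelledTree n // T.fixedVertexCount ≤ k} ≤ 4 ^ ((n + 5 * k) / 2 + 3) := by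
  have hcode : ∀ T : {T : UnlabelledTree n // T.fixedVertexCount ≤ k},
      ∃ (G : {G : SimpleGraph (Fin n) // G.IsTree}) (d e c : BinaryTree Unit),
        Quotient.mk (treeSetoid n) G = T.1 ∧
        forestClass G.1.centralParent = 2 • treeClass d + 3 • treeClass e + coreClass c ∧
        2 * (d.numNodes + e.numNodes + c.numNodes) ≤ n + 5 * k := by
    rintro ⟨T, hT⟩
    obtain ⟨G, rfl⟩ := Quotient.exists_rep T
    obtain ⟨d, e, c, h, h'⟩ := G.2.isForest_centralParent.exists_core
    have hk : (fixedSet G.1.centralParent).ncard ≤ k :=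
      (SimpleGraph.ncard_fixedSet_centralParent_le G.2).trans hT
    rw [Nat.card_eq_fintype_card, Fintype.card_fin] at h'
    exact ⟨G, d, e, c, rfl, h, by omega⟩
  choose G d e c hG hclass hsize using hcode
  obtain ⟨hcard, hfin⟩ := card_trees_numNodes_le ((n + 5 * k) / 2 + 2)
  -- The three parts of the code are packed into one binary tree with two additional nodes.
  let f : {T : UnlabelledTree n // T.fixedVertexCount ≤ k} →
      {t : BinaryTree Unit // t.numNodes ≤ (n + 5 * k) / 2 + 2} := fun T =>
    ⟨.node () (.node () (d T) (e T)) (c T), by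
      have := hsize T
      simp only [BinaryTree.numNodes]
      omega⟩
  refine (Nat.card_le_card_of_injective f fun T T' h => ?_).trans hcard
  have h' := congrArg Subtype.val h
  simp only [f, BinaryTree.node.injEq, true_and] at h'
  obtain ⟨⟨hd, he⟩, hc⟩ := h'
  obtain ⟨φ⟩ := forestClass_eq_iff.1
    ((hclass T).trans ((by rw [hd, he, hc] : _ = _).trans (hclass T').symm))
  apply Subtype.ext
  rw [← hG T, ← hG T']
  exact Quotient.sound (SimpleGraph.nonempty_iso_of_centralParent (G T).2 (G T').2 φ)

/-! ### Counting labelled rooted trees -/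

section ParentFunctions

variable {α : Type}

/-- The relation `x ↦ p x` of a partial parent function `p`; roots have the value `none`. -/
def funRel (p : α → Option α) (x y : α) : Prop := p x = some y

theorem isRoot_funRel {p : α → Option α} {x : α} : IsRoot (funRel p) x ↔ p x = none := by
  simp [IsRoot, funRel, Option.eq_none_iff_forall_ne_some]

theorem isForest_funRel {p : α → Option α} (h : WellFounded (Function.swap (funRel p))) :
    IsForest (funRel p) :=
  ⟨h, fun h₁ h₂ => Option.some_injective _ (h₁.symm.trans h₂)⟩

/-- Hanging a root `x` of a forest below a vertex `v` of another tree yields a forest. -/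
theorem IsForest.update [DecidableEq α] {p : α → Option α} (h : IsForest (funRel p)) {x v : α}
    (hx : p x = none) (hv : h.root v ≠ x) :
    IsForest (funRel (Function.update p x (some v))) := by
  have hne : ∀ y, h.root y ≠ x → y ≠ x := by
    rintro y hy rfl
    exact hy (h.root_of_isRoot (isRoot_funRel.2 hx))
  -- Trees other than that of `x` are unchanged; then `x` is accessible through `v`, and all other
  -- vertices of its tree are accessible through `x`.
  have h₁ : ∀ y, h.root y ≠ x →
      Acc (Function.swap (funRel (Function.update p x (some v)))) y := by
    intro y
    induction y using h.wf.induction with | h y ih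
    intro hy
    refine ⟨_, fun z hz => ?_⟩
    have hz' : funRel p y z := by
      simpa [Function.swap, funRel, Function.update_of_ne (hne y hy)] using hz
    exact ih z hz' (by rwa [← h.root_of_parent hz'])
  have h₂ : Acc (Function.swap (funRel (Function.update p x (some v)))) x := by
    refine ⟨_, fun z hz => ?_⟩
    have hz' : v = z := by simpa [Function.swap, funRel] using hz
    exact hz' ▸ h₁ v hv
  refine isForest_funRel ⟨fun y => ?_⟩
  induction y using h.wf.induction with | h y ih
  by_cases hyx : y = x
  · exact hyx ▸ h₂
  · refine ⟨_, fun z hz => ih z ?_⟩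
    simpa [Function.swap, funRel, Function.update_of_ne hyx] using hz

open Classical in
/-- The parent functions of the rooted forests with `k` edges on a given set of vertices. -/
noncomputable def forestFuns (α : Type) [Fintype α] (k : ℕ) : Finset (α → Option α) :=
  Finset.univ.filter fun p =>
    IsForest (funRel p) ∧ (Finset.univ.filter fun x => p x ≠ none).card = k

theorem mem_forestFuns [Fintype α] {k : ℕ} {p : α → Option α} : p ∈ forestFuns α k ↔
    IsForest (funRel p) ∧ (Finset.univ.filter fun x => p x ≠ none).card = k := by
  classical
  simp only [forestFuns, Finset.mem_filter, Finset.mem_univ, true_and]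

/-- Forests with a new edge are counted in two ways: a forest with `k` edges can be extended by an
edge from any vertex to any root of another tree, and each of the `k + 1` edges of a larger forest
may be the new one. -/
theorem card_forestFuns_succ [Fintype α] (k : ℕ) :
    (forestFuns α k).card * (Fintype.card α * (Fintype.card α - k - 1)) ≤
      (forestFuns α (k + 1)).card * (k + 1) := by
  classical
  -- The root function is made total, so that it can be used inside a sum over all functions.
  let ρ : (α → Option α) → α → α := fun p v =>
    if h : IsForest (funRel p) then h.root v else v
  have hρ : ∀ p (h : IsForest (funRel p)) v, ρ p v = h.root v := fun p h v => dif_pos h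
  let A : Finset (Σ _ : α → Option α, Σ _ : α, α) := (forestFuns α k).sigma fun p =>
    (Finset.univ : Finset α).sigma fun v => (Finset.univ.filter fun x => p x = none).erase (ρ p v)
  let B : Finset (Σ _ : α → Option α, α) :=
    (forestFuns α (k + 1)).sigma fun p => Finset.univ.filter fun x => p x ≠ none
  have hA : A.card = (forestFuns α k).card * (Fintype.card α * (Fintype.card α - k - 1)) := by
    rw [Finset.card_sigma, ← smul_eq_mul]
    refine Finset.sum_eq_card_nsmul fun p hp => ?_
    rw [Finset.card_sigma, ← smul_eq_mul, ← Finset.card_univ]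
    refine Finset.sum_eq_card_nsmul fun v _ => ?_
    obtain ⟨h, hk⟩ := mem_forestFuns.1 hp
    have hc := Finset.card_filter_add_card_filter_not (s := (Finset.univ : Finset α))
      (fun x => p x = none)
    rw [Finset.card_erase_of_mem]
    · simp only [ne_eq] at hk
      omega
    · simpa [hρ p h v] using isRoot_funRel.1 (h.isRoot_root v)
  have hB : B.card = (forestFuns α (k + 1)).card * (k + 1) := by
    rw [Finset.card_sigma, ← smul_eq_mul]
    exact Finset.sum_eq_card_nsmul fun p hp => (mem_forestFuns.1 hp).2
  rw [← hA, ← hB]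
  refine Finset.card_le_card_of_injOn
    (fun a => ⟨Function.update a.1 a.2.2 (some a.2.1), a.2.2⟩) ?_ ?_
  · rintro ⟨p, v, x⟩ ha
    simp only [A, Finset.mem_coe, Finset.mem_sigma, Finset.mem_univ, true_and, Finset.mem_erase,
      Finset.mem_filter, mem_forestFuns] at ha
    obtain ⟨⟨h, hk⟩, hx, hpx⟩ := ha
    simp only [B, Finset.mem_coe, Finset.mem_sigma, Finset.mem_univ, true_and, Finset.mem_filter,
      mem_forestFuns, Function.update_self]
    refine ⟨⟨h.update hpx (by rw [← hρ p h]; exact hx.symm), ?_⟩, by simp⟩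
    have : (Finset.univ.filter fun y => Function.update p x (some v) y ≠ none) =
        insert x (Finset.univ.filter fun y => p y ≠ none) := by
      ext y
      by_cases hy : y = x
      · subst hy; simp
      · simp [hy]
    rw [this, Finset.card_insert_of_notMem (by simp [hpx]), hk]
  · rintro ⟨p, v, x⟩ ha ⟨q, w, y⟩ hb hab
    simp only [A, Finset.mem_coe, Finset.mem_sigma, Finset.mem_univ, true_and, Finset.mem_erase,
      Finset.mem_filter] at ha hb
    simp only [Sigma.mk.injEq, heq_eq_eq] at hab
    obtain ⟨hpq, rfl⟩ := hab
    have hvw : v = w := by simpa using congrFun hpq x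
    have : p = q := by
      funext z
      by_cases hz : z = x
      · rw [hz, ha.2.2, hb.2.2]
      · simpa [Function.update_of_ne hz] using congrFun hpq z
    subst hvw this
    rfl

/-- There are at least `(n + 1) ^ n` rooted labelled trees with `n + 1` vertices, which are the
rooted forests with `n` edges. -/
theorem card_pow_le_card_forestFuns [Fintype α] (n : ℕ) (hn : Fintype.card α = n + 1) :
    (n + 1) ^ n ≤ (forestFuns α n).card := by
  have key : ∀ k ≤ n, (n + 1) ^ k * n.factorial ≤
      (forestFuns α k).card * (k.factorial * (n - k).factorial) := by
    intro k
    induction k with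
    | zero =>
      intro _
      have : (fun _ => none) ∈ forestFuns α 0 := by
        refine mem_forestFuns.2 ⟨isForest_funRel ⟨fun x => ⟨_, fun y hy => ?_⟩⟩, by simp⟩
        simp [Function.swap, funRel] at hy
      have : 1 ≤ (forestFuns α 0).card := Finset.card_pos.2 ⟨_, this⟩
      simpa using Nat.mul_le_mul_right n.factorial this
    | succ k ih =>
      intro hk
      have h₁ := ih (by omega)
      have h₂ := card_forestFuns_succ (α := α) k
      obtain ⟨m, rfl⟩ : ∃ m, n = k + 1 + m := ⟨n - (k + 1), by omega⟩
      rw [hn, show k + 1 + m + 1 - k - 1 = m + 1 by omega] at h₂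
      rw [show k + 1 + m - k = m + 1 by omega] at h₁
      rw [show k + 1 + m - (k + 1) = m by omega]
      calc (k + 1 + m + 1) ^ (k + 1) * (k + 1 + m).factorial
          = (k + 1 + m + 1) * ((k + 1 + m + 1) ^ k * (k + 1 + m).factorial) := by ring
        _ ≤ (k + 1 + m + 1) *
            ((forestFuns α k).card * (k.factorial * (m + 1).factorial)) := by gcongr
        _ = ((forestFuns α k).card * ((k + 1 + m + 1) * (m + 1))) *
            (k.factorial * m.factorial) := by rw [Nat.factorial_succ m]; ring
        _ ≤ ((forestFuns α (k + 1)).card * (k + 1)) * (k.factorial * m.factorial) := by gcongr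
        _ = (forestFuns α (k + 1)).card * ((k + 1).factorial * m.factorial) := by
          rw [Nat.factorial_succ k]; ring
  have h := key n le_rfl
  rw [Nat.sub_self, Nat.factorial_zero, mul_one] at h
  exact Nat.le_of_mul_le_mul_right h n.factorial_pos

/-- The graph in which every vertex is joined to its parent. -/
def funGraph (p : α → Option α) : SimpleGraph α := SimpleGraph.fromRel (funRel p)

theorem IsForest.not_funRel_symm {p : α → Option α} (h : IsForest (funRel p)) {x y : α}
    (hxy : p x = some y) : p y ≠ some x :=
  fun hyx => h.wf.asymmetric (a := y) (b := x) hxy hyx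

theorem funGraph_adj {p : α → Option α} (h : IsForest (funRel p)) {x y : α} :
    (funGraph p).Adj x y ↔ p x = some y ∨ p y = some x := by
  rw [funGraph, SimpleGraph.fromRel_adj, and_iff_right_of_imp]
  · rfl
  · rintro (hxy | hxy) rfl <;> exact h.not_funRel_symm hxy hxy

theorem exists_root_of_mem_forestFuns [Fintype α] {n : ℕ} (hn : Fintype.card α = n + 1)
    {p : α → Option α} (hp : p ∈ forestFuns α n) : ∃ o, ∀ x, p x = none ↔ x = o := by
  classical
  have hc := Finset.card_filter_add_card_filter_not (s := (Finset.univ : Finset α))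
    (fun x => p x = none)
  have hp' := (mem_forestFuns.1 hp).2
  simp only [ne_eq] at hp'
  rw [hp', Finset.card_univ, hn] at hc
  obtain ⟨o, ho⟩ := Finset.card_eq_one.1
    (show (Finset.univ.filter fun x => p x = none).card = 1 by omega)
  exact ⟨o, fun x => by simpa using Finset.ext_iff.1 ho x⟩

theorem isTree_funGraph [Fintype α] {n : ℕ} (hn : Fintype.card α = n + 1)
    {p : α → Option α} (hp : p ∈ forestFuns α n) : (funGraph p).IsTree := by
  classical
  obtain ⟨o, ho⟩ := exists_root_of_mem_forestFuns hn hp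
  obtain ⟨h, hk⟩ := mem_forestFuns.1 hp
  have hreach : ∀ x, (funGraph p).Reachable x o := by
    intro x
    induction x using h.wf.induction with | h x ih
    cases hx : p x with
    | none => rw [(ho x).1 hx]
    | some y => exact ((funGraph_adj h).2 (Or.inl hx)).reachable.trans (ih y hx)
  have hconn : (funGraph p).Connected :=
    { preconnected := fun x y => (hreach x).trans (hreach y).symm
      nonempty := ⟨o⟩ }
  rw [SimpleGraph.isTree_iff_connected_and_card]
  refine ⟨hconn, le_antisymm ?_ hconn.card_vert_le_card_edgeSet_add_one⟩
  have hsub : (funGraph p).edgeSet ⊆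
      (fun x => s(x, (p x).getD x)) '' {x | p x ≠ none} := by
    intro e
    induction e using Sym2.ind with | h x y
    rw [SimpleGraph.mem_edgeSet, funGraph_adj h]
    rintro (hxy | hxy)
    · exact ⟨x, by simp [hxy], by simp [hxy]⟩
    · exact ⟨y, by simp [hxy], by simp [hxy]⟩
  have h₁ := (Set.ncard_le_ncard hsub (Set.toFinite _)).trans (Set.ncard_image_le (Set.toFinite _))
  have h₂ : {x | p x ≠ none}.ncard = n := by
    rw [← hk, ← Set.ncard_coe_finset]
    simp
  rw [Nat.card_coe_set_eq, Nat.card_eq_fintype_card, hn]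
  omega

/-- A parent function is determined by its graph and its roots. -/
theorem eq_of_funGraph_eq {p q : α → Option α} (hp : IsForest (funRel p))
    (hq : IsForest (funRel q)) (hroot : ∀ x, p x = none ↔ q x = none)
    (h : funGraph p = funGraph q) : p = q := by
  funext x
  induction x using hp.wf.induction with | h x ih
  cases hx : p x with
  | none => exact ((hroot x).1 hx).symm
  | some y =>
    have hadj : (funGraph q).Adj x y := h ▸ (funGraph_adj hp).2 (Or.inl hx)
    rcases (funGraph_adj hq).1 hadj with hxy | hxy
    · exact hxy.symm
    · exact absurd ((ih y hx).trans hxy) (hp.not_funRel_symm hx)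

end ParentFunctions

/-- The factor `n + 1` on the right accounts for the choice of a root. -/
theorem card_labelledTrees_ge (n : ℕ) :
    (n + 1) ^ n ≤ Nat.card {G : SimpleGraph (Fin (n + 1)) // G.IsTree} * (n + 1) := by
  classical
  have hn : Fintype.card (Fin (n + 1)) = n + 1 := Fintype.card_fin _
  refine (card_pow_le_card_forestFuns n hn).trans ?_
  have hroot : ∀ p : forestFuns (Fin (n + 1)) n, ∃ o, ∀ x, p.1 x = none ↔ x = o := fun p =>
    exists_root_of_mem_forestFuns hn p.2
  choose o ho using hroot
  let f : forestFuns (Fin (n + 1)) n → {G : SimpleGraph (Fin (n + 1)) // G.IsTree} × Fin (n + 1) :=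
    fun p => (⟨funGraph p.1, isTree_funGraph hn p.2⟩, o p)
  have hf : Function.Injective f := by
    intro p q hpq
    simp only [f, Prod.mk.injEq, Subtype.mk.injEq] at hpq
    refine Subtype.ext (eq_of_funGraph_eq (mem_forestFuns.1 p.2).1 (mem_forestFuns.1 q.2).1
      (fun x => ?_) hpq.1)
    rw [ho, ho, hpq.2]
  have := Nat.card_le_card_of_injective f hf
  rwa [Nat.card_prod, Nat.card_fin, Nat.card_eq_fintype_card, Fintype.card_coe] at this

/-- A labelled tree is determined by its isomorphism class and an isomorphism with the chosen
representative of the class. -/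
theorem card_labelledTrees_le (n : ℕ) :
    Nat.card {G : SimpleGraph (Fin n) // G.IsTree} ≤
      Nat.card (UnlabelledTree n) * n.factorial := by
  have hiso : ∀ G : {G : SimpleGraph (Fin n) // G.IsTree},
      Nonempty (((Quotient.mk (treeSetoid n) G).out).1 ≃g G.1) := fun G => Quotient.mk_out G
  let f : {G : SimpleGraph (Fin n) // G.IsTree} → UnlabelledTree n × Equiv.Perm (Fin n) := fun G =>
    (Quotient.mk (treeSetoid n) G, (hiso G).some.toEquiv)
  have hf : Function.Injective f := by
    intro G H hGH
    have h₁ : Quotient.mk (treeSetoid n) G = Quotient.mk (treeSetoid n) H :=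
      congrArg Prod.fst hGH
    have h₂ : (hiso G).some.toEquiv = (hiso H).some.toEquiv := congrArg Prod.snd hGH
    have key : ∀ x y, G.1.Adj x y ↔ H.1.Adj x y := by
      intro x y
      obtain ⟨x, rfl⟩ := (hiso G).some.surjective x
      obtain ⟨y, rfl⟩ := (hiso G).some.surjective y
      have hx : ∀ x, (hiso G).some x = (hiso H).some x := fun x => congrArg (fun e => e x) h₂
      rw [(hiso G).some.map_adj_iff, hx, hx, (hiso H).some.map_adj_iff, h₁]
    exact Subtype.ext (SimpleGraph.ext (by ext x y; exact key x y))
  have := Nat.card_le_card_of_injective f hf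
  rwa [Nat.card_prod, Nat.card_eq_fintype_card (α := Equiv.Perm (Fin n)), Fintype.card_perm,
    Fintype.card_fin] at this

/-! ### Comparison of the two counts -/

/-- A lower bound for the number of trees, from the count of labelled trees: a tree has at most
`n!` labellings. -/
theorem pow_le_card_unlabelledTree {n : ℕ} (hn : 0 < n) :
    n ^ n ≤ Nat.card (UnlabelledTree n) * (n.factorial * n ^ 2) := by
  obtain ⟨m, rfl⟩ : ∃ m, n = m + 1 := ⟨n - 1, by omega⟩
  calc (m + 1) ^ (m + 1) = (m + 1) ^ m * (m + 1) := pow_succ _ _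
    _ ≤ Nat.card {G : SimpleGraph (Fin (m + 1)) // G.IsTree} * (m + 1) * (m + 1) := by
      gcongr
      exact card_labelledTrees_ge m
    _ ≤ Nat.card (UnlabelledTree (m + 1)) * (m + 1).factorial * (m + 1) * (m + 1) := by
      gcongr
      exact card_labelledTrees_le _
    _ = _ := by ring

/-- The trees with few fixed vertices grow at most like `(5 / 2) ^ n`. -/
theorem card_few_fixed_le (n : ℕ) :
    (Nat.card {T : UnlabelledTree n // T.fixedVertexCount ≤ ⌊(n : ℝ) / 24⌋₊} : ℝ) ≤
      64 * (5 / 2) ^ n := by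
  have hfloor : ⌊(n : ℝ) / 24⌋₊ = n / 24 := by
    simpa using Nat.floor_div_eq_div (K := ℝ) n 24
  rw [hfloor]
  have h := card_fixedVertexCount_le n (n / 24)
  have hexp : 48 * ((n + 5 * (n / 24)) / 2) ≤ 29 * n := by omega
  generalize (n + 5 * (n / 24)) / 2 = N at h hexp
  -- The base `5 / 2` lies between `4 ^ (29 / 48)`, which is about `2.31`, and `e`.
  have hpow : (4 : ℝ) ^ N ≤ (5 / 2) ^ n := by
    refine le_of_pow_le_pow_left₀ (n := 48) (by norm_num) (by positivity) ?_
    calc ((4 : ℝ) ^ N) ^ 48 = 4 ^ (48 * N) := by rw [← pow_mul, mul_comm]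
      _ ≤ 4 ^ (29 * n) := pow_le_pow_right₀ (by norm_num) hexp
      _ = (4 ^ 29) ^ n := pow_mul _ _ _
      _ ≤ ((5 / 2) ^ 48) ^ n := by
        gcongr
        norm_num
      _ = ((5 / 2) ^ n) ^ 48 := by rw [← pow_mul, ← pow_mul, mul_comm]
  calc (Nat.card {T : UnlabelledTree n // T.fixedVertexCount ≤ n / 24} : ℝ)
      ≤ 4 ^ (N + 3) := by exact_mod_cast h
    _ = 64 * 4 ^ N := by ring
    _ ≤ 64 * (5 / 2) ^ n := by gcongr

/-- The ratio of consecutive terms tends to `(5 / 2) / e < 1`. -/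
theorem tendsto_factorial_ratio :
    Filter.Tendsto (fun n : ℕ => (5 / 2 : ℝ) ^ n * n ^ 2 * n.factorial / n ^ n)
      Filter.atTop (nhds 0) := by
  refine Summable.tendsto_atTop_zero (summable_of_ratio_test_tendsto_lt_one
    (l := 5 / 2 * (1 + 0) ^ 2 / Real.exp 1) ?_ ?_ ?_)
  · rw [div_lt_one (Real.exp_pos 1)]
    have := Real.exp_one_gt_d9
    linarith
  · filter_upwards [Filter.eventually_gt_atTop 0] with n hn
    have : (0 : ℝ) < n := by exact_mod_cast hn
    positivity
  · have h₁ : Filter.Tendsto (fun n : ℕ => 1 + 1 / (n : ℝ)) Filter.atTop (nhds (1 + 0)) :=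
      tendsto_const_nhds.add tendsto_one_div_atTop_nhds_zero_nat
    have h₂ := ((h₁.pow 2).const_mul (5 / 2)).div (Real.tendsto_one_add_div_pow_exp 1)
      (Real.exp_pos 1).ne'
    refine h₂.congr' ?_
    filter_upwards [Filter.eventually_gt_atTop 0] with n hn
    have hn' : (0 : ℝ) < n := by exact_mod_cast hn
    have he : (1 + 1 / (n : ℝ)) = (n + 1) / n := by field_simp
    rw [Real.norm_of_nonneg (by positivity), Real.norm_of_nonneg (by positivity)]
    simp only [Pi.div_apply]
    rw [he, Nat.factorial_succ, div_pow, div_pow]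
    push_cast
    rw [pow_succ ((n : ℝ) + 1) n]
    field_simp
    ring

theorem mainTheorem4 :
    AlmostEveryTree (fun (n : ℕ) (T : UnlabelledTree n) =>
      ⌊(n : ℝ) / 24⌋₊ < T.fixedVertexCount) := by
  have hlim : Filter.Tendsto
      (fun n : ℕ => 1 - 64 * ((5 / 2 : ℝ) ^ n * n ^ 2 * n.factorial / n ^ n))
      Filter.atTop (nhds 1) := by
    simpa using (tendsto_factorial_ratio.const_mul 64).const_sub 1
  refine tendsto_of_tendsto_of_tendsto_of_le_of_le' hlim tendsto_const_nhds ?_ ?_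
  · filter_upwards [Filter.eventually_gt_atTop 0] with n hn
    have hn' : (0 : ℝ) < n := by exact_mod_cast hn
    have hpow : (n : ℝ) ^ n ≤ Nat.card (UnlabelledTree n) * (n.factorial * n ^ 2) := by
      exact_mod_cast pow_le_card_unlabelledTree hn
    have hpos : (0 : ℝ) < Nat.card (UnlabelledTree n) :=
      pos_of_mul_pos_left ((pow_pos hn' n).trans_le hpow) (by positivity)
    have hfew := card_few_fixed_le n
    have hsum : (Nat.card (UnlabelledTree n) : ℝ) =
        Nat.card {T : UnlabelledTree n // ⌊(n : ℝ) / 24⌋₊ < T.fixedVertexCount} +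
        Nat.card {T : UnlabelledTree n // T.fixedVertexCount ≤ ⌊(n : ℝ) / 24⌋₊} := by
      classical
      rw [← Nat.cast_add, ← Nat.card_sum]
      congr 1
      refine Nat.card_congr ((Equiv.sumCompl fun T : UnlabelledTree n =>
        ⌊(n : ℝ) / 24⌋₊ < T.fixedVertexCount).symm.trans
        (Equiv.sumCongr (Equiv.refl _) (Equiv.subtypeEquivRight fun T => not_lt)))
    rw [treeProb, le_div_iff₀ hpos, sub_mul, one_mul]
    have hmul : (5 / 2 : ℝ) ^ n ≤
        (5 / 2 : ℝ) ^ n * n ^ 2 * n.factorial / n ^ n * Nat.card (UnlabelledTree n) := by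
      rw [div_mul_eq_mul_div, le_div_iff₀ (by positivity)]
      calc (5 / 2 : ℝ) ^ n * n ^ n
          ≤ (5 / 2 : ℝ) ^ n * (Nat.card (UnlabelledTree n) * (n.factorial * n ^ 2)) := by gcongr
        _ = _ := by ring
    linarith
  · refine Filter.Eventually.of_forall fun n => div_le_one_of_le₀ ?_ (by positivity)
    exact_mod_cast Nat.card_le_card_of_injective _ Subtype.val_injective
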